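/- Let $R$ be a field. All homology and cohomology is singular with coefficients in $R$. A path-connected (nonempty) topological space $X$ is an $R$-Poincaré space of formal dimension $n$ if there is $\mu\in H_n(X;R)\cong R$ such that $x\mapsto x\cap\mu$ is an isomorphism $H^k(X;R)\to H_{n-k}(X;R)$ for every integer $k$ (groups in negative degrees being zero). The cup-length $\operatorname{cup}_R(X)$ is the supremum of all $c\ge 0$ for which there are classes $a_1,\dots,a_c\in H^*(X;R)$ of positive degrees with $a_1\cup\dots\cup a_c\neq 0$. The height $\operatorname{ht}_R(x)$ of a nonzero class $x$ of positive degree is the supremum of all $m$ with $x^m\neq 0$. **Theorem A.** Let $X$ be a path-connected $R$-Poincaré space of formal dimension $n$ having a nonzero reduced cohomology group in some degree less than $n$. Let $r<n$ be the smallest such degree, and let $q$ be the second smallest such degree; if there is only one such degree, put $q=r$. Then $r\ge 1$ and the following hold. (a) One always has $$\operatorname{cup}_R(X)\le \frac{n}{r}.\tag{a1}$$ If there is a class $x\in H^r(X;R)\setminus\{0\}$ such that $r\cdot\operatorname{ht}_R(x)=n$, then $$\operatorname{cup}_R(X)=\frac{n}{r}.\tag{a2}$$ If there are $a_1,\dots,a_s\in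 H^r(X;R)\setminus\{0\}$ and non-negative integers $t_1,\dots,t_s$ with $t_1+\dots+t_s>0$, $r(t_1+\dots+t_s)<n$ and $a_1^{t_1}\cdots a_s^{t_s}\neq 0$, then $$\operatorname{cup}_R(X)\ge 1+t_1+\dots+t_s.\tag{a3}$$ (b) Suppose that $r<q$ and that the $R$-vector space $H^r(X;R)$ has a finite basis $a(1),\dots,a(t)$ such that $a(1)^{k_1+1}=0,\dots,a(t)^{k_t+1}=0$ for some positive integers $k_1,\dots,k_t$ with $r(k_1+\dots+k_t)<n$. Then $$\operatorname{cup}_R(X)\le k_1+\dots+k_t+\left[\frac{n-r(k_1+\dots+k_t)}{q}\right]<\frac{n}{r},\tag{b1}$$ where $[\,\cdot\,]$ denotes the integer part. -/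

import Mathlib

/-!
Singular homology and cohomology of topological spaces with coefficients in a commutative ring,
with cup and cap products, cup-length, height and Poincaré spaces.

Chains and cochains are written down for an arbitrary simplicial set `S`; the singular theory of
a space `X` is the case `S = Sing X`, the singular simplicial set of `X`.
-/

namespace SingularTheory

open CategoryTheory Opposite

universe u v

section SimplicialSet

variable (R : Type v) [CommRing R] (S : SSet.{u})

/-- The set of `k`-simplices of a simplicial set. -/
abbrev Simplices (k : ℕ) : Type u := S.obj (op (SimplexCategory.mk k))

/-! ### Cochains and cohomology -/

/-- The module of `k`-cochains: all functions on the set of `k`-simplices. -/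
abbrev Cochain (k : ℕ) : Type (max u v) := Simplices S k → R

/-- The coboundary `(δ f)(σ) = ∑ᵢ (-1)ⁱ f(dᵢ σ)`. -/
def coboundary (k : ℕ) : Cochain R S k →ₗ[R] Cochain R S (k + 1) where
  toFun f σ := ∑ i : Fin (k + 2), (-1 : R) ^ (i : ℕ) * f (S.δ i σ)
  map_add' f g := by
    funext σ
    simp [mul_add, Finset.sum_add_distrib]
  map_smul' c f := by
    funext σ
    simp only [Pi.smul_apply, smul_eq_mul, RingHom.id_apply, Finset.mul_sum]
    exact Finset.sum_congr rfl fun i _ => by ring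

/-- The cocycles of degree `k`. -/
def cocycles (k : ℕ) : Submodule R (Cochain R S k) := LinearMap.ker (coboundary R S k)

/-- The coboundaries of degree `k`. -/
def coboundaries : (k : ℕ) → Submodule R (Cochain R S k)
  | 0 => ⊥
  | k + 1 => LinearMap.range (coboundary R S k)

/-- The coboundaries of degree `k` in the cochain complex augmented by `R → C⁰`, which sends a
scalar to the corresponding constant `0`-cochain. -/
def reducedCoboundaries : (k : ℕ) → Submodule R (Cochain R S k)
  | 0 => Submodule.span R {fun _ => 1}
  | k + 1 => LinearMap.range (coboundary R S k)

/-- The cohomology module `Hᵏ(S; R)`. -/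
def Cohomology (k : ℕ) : Type (max u v) :=
  cocycles R S k ⧸ (coboundaries R S k).submoduleOf (cocycles R S k)

instance (k : ℕ) : AddCommGroup (Cohomology R S k) :=
  inferInstanceAs (AddCommGroup (_ ⧸ (coboundaries R S k).submoduleOf (cocycles R S k)))

instance (k : ℕ) : Module R (Cohomology R S k) :=
  inferInstanceAs (Module R (_ ⧸ (coboundaries R S k).submoduleOf (cocycles R S k)))

/-- The reduced cohomology module of degree `k` of a nonempty simplicial set. -/
def ReducedCohomology (k : ℕ) : Type (max u v) :=
  cocycles R S k ⧸ (reducedCoboundaries R S k).submoduleOf (cocycles R S k)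

instance (k : ℕ) : AddCommGroup (ReducedCohomology R S k) :=
  inferInstanceAs (AddCommGroup (_ ⧸ (reducedCoboundaries R S k).submoduleOf (cocycles R S k)))

instance (k : ℕ) : Module R (ReducedCohomology R S k) :=
  inferInstanceAs (Module R (_ ⧸ (reducedCoboundaries R S k).submoduleOf (cocycles R S k)))

/-- The cohomology class of a cocycle. -/
def cohomologyClass (k : ℕ) : cocycles R S k →ₗ[R] Cohomology R S k :=
  ((coboundaries R S k).submoduleOf (cocycles R S k)).mkQ

/-! ### Chains and homology -/

/-- The module of `k`-chains: the free module on the set of `k`-simplices. -/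
def Chain (k : ℕ) : Type (max u v) := Simplices S k →₀ R

noncomputable instance (k : ℕ) : AddCommGroup (Chain R S k) :=
  inferInstanceAs (AddCommGroup (Simplices S k →₀ R))

noncomputable instance (k : ℕ) : Module R (Chain R S k) :=
  inferInstanceAs (Module R (Simplices S k →₀ R))

variable {S} in
/-- A simplex, considered as a chain. -/
noncomputable def simplexChain {k : ℕ} (σ : Simplices S k) : Chain R S k :=
  Finsupp.single σ (1 : R)

variable {R S} in
/-- The linear extension to chains of a map defined on simplices. -/
noncomputable def chainLift {M : Type*} [AddCommGroup M] [Module R M] {k : ℕ}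
    (φ : Simplices S k → M) : Chain R S k →ₗ[R] M :=
  (Finsupp.linearCombination R φ : (Simplices S k →₀ R) →ₗ[R] M)

variable {R S} in
theorem chainLift_simplexChain {M : Type*} [AddCommGroup M] [Module R M] {k : ℕ}
    (φ : Simplices S k → M) (σ : Simplices S k) : chainLift φ (simplexChain R σ) = φ σ := by
  refine (Finsupp.linearCombination_single R (1 : R) σ).trans ?_
  rw [one_smul]

variable {R S} in
theorem chain_hom_ext {M : Type*} [AddCommGroup M] [Module R M] {k : ℕ}
    {F G : Chain R S k →ₗ[R] M} (h : ∀ σ, F (simplexChain R σ) = G (simplexChain R σ)) :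
    F = G := by
  refine Finsupp.lhom_ext' (M := R) (φ := F) (ψ := G) fun σ => LinearMap.ext_ring ?_
  exact h σ

/-- The boundary `∂ σ = ∑ᵢ (-1)ⁱ dᵢ σ`. -/
noncomputable def boundary (k : ℕ) : Chain R S (k + 1) →ₗ[R] Chain R S k :=
  chainLift fun σ => ∑ i : Fin (k + 2), (-1 : R) ^ (i : ℕ) • simplexChain R (S.δ i σ)

/-- The cycles of degree `k`. -/
noncomputable def cycles : (k : ℕ) → Submodule R (Chain R S k)
  | 0 => ⊤
  | k + 1 => LinearMap.ker (boundary R S k)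

/-- The boundaries of degree `k`. -/
noncomputable def boundaries (k : ℕ) : Submodule R (Chain R S k) :=
  LinearMap.range (boundary R S k)

/-- The homology module `H_k(S; R)`. -/
def Homology (k : ℕ) : Type (max u v) :=
  cycles R S k ⧸ (boundaries R S k).submoduleOf (cycles R S k)

noncomputable instance (k : ℕ) : AddCommGroup (Homology R S k) :=
  inferInstanceAs (AddCommGroup (_ ⧸ (boundaries R S k).submoduleOf (cycles R S k)))

noncomputable instance (k : ℕ) : Module R (Homology R S k) :=
  inferInstanceAs (Module R (_ ⧸ (boundaries R S k).submoduleOf (cycles R S k)))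

/-- The homology class of a cycle. -/
noncomputable def homologyClass (k : ℕ) : cycles R S k →ₗ[R] Homology R S k :=
  ((boundaries R S k).submoduleOf (cycles R S k)).mkQ

/-! ### Products of chains and cochains -/

variable {S} in
/-- The face of an `n`-simplex spanned by the vertices `a, a + 1, …, a + k`. -/
def face {n : ℕ} (a k : ℕ) (h : a + k ≤ n) (σ : Simplices S n) :
    Simplices S k :=
  S.map (SimplexCategory.subinterval a k h).op σ

/-- The cup product of cochains:
`(f ∪ g)(σ) = f(σ|[v₀, …, vᵢ]) * g(σ|[vᵢ, …, vᵢ₊ⱼ])`. -/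
def cupCochain {i j n : ℕ} (h : i + j = n) :
    Cochain R S i →ₗ[R] Cochain R S j →ₗ[R] Cochain R S n :=
  LinearMap.mk₂ R
    (fun f g σ => f (face 0 i (by lia) σ) * g (face i j (by lia) σ))
    (fun f f' g => by funext σ; simp [add_mul])
    (fun c f g => by funext σ; simp [mul_assoc])
    (fun f g g' => by funext σ; simp [mul_add])
    (fun c f g => by funext σ; simp [mul_left_comm])

/-- The cap product of a cochain and a chain:
`f ∩ σ = f(σ|[v₀, …, vᵢ]) • σ|[vᵢ, …, vᵢ₊ⱼ]`. -/
noncomputable def capChain {i j n : ℕ} (h : i + j = n) :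
    Cochain R S i →ₗ[R] Chain R S n →ₗ[R] Chain R S j :=
  LinearMap.mk₂ R
    (fun f c => chainLift (fun σ : Simplices S n =>
      f (face 0 i (by lia) σ) • simplexChain R (face i j (by lia) σ)) c)
    (fun f f' c => by
      rw [← LinearMap.add_apply]
      congr 1
      exact chain_hom_ext fun σ => by
        simp only [LinearMap.add_apply, chainLift_simplexChain, Pi.add_apply, add_smul])
    (fun a f c => by
      rw [← LinearMap.smul_apply]
      congr 1
      exact chain_hom_ext fun σ => by
        simp only [LinearMap.smul_apply, chainLift_simplexChain, Pi.smul_apply, smul_assoc])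
    (fun f c c' => map_add _ _ _)
    (fun a f c => map_smul _ _ _)

end SimplicialSet

section Products

variable {R : Type v} [CommRing R] {S : SSet.{u}}

/-! ### Compatibility of the products with the differentials -/

/-- The effect on vertices of the inclusion of a face, as a natural number. -/
theorem subinterval_val {n : ℕ} (a k : ℕ) (h : a + k ≤ n) (x : Fin (k + 1)) :
    (((SimplexCategory.subinterval (n := n) a k h).toOrderHom x : Fin (n + 1)) : ℕ) = x + a :=
  rfl

theorem delta_val {n : ℕ} (m : Fin (n + 2)) (x : Fin (n + 1)) :
    (((SimplexCategory.δ m).toOrderHom x : Fin (n + 2)) : ℕ) =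
      if (x : ℕ) < m then (x : ℕ) else x + 1 := by
  change ((m.succAbove x : Fin (n + 2)) : ℕ) = _
  simp only [Fin.succAbove, Fin.lt_def, Fin.val_castSucc]
  split_ifs <;> rfl

theorem comp_val {a b c : ℕ} (f : SimplexCategory.mk a ⟶ SimplexCategory.mk b)
    (g : SimplexCategory.mk b ⟶ SimplexCategory.mk c) (x : Fin (a + 1)) :
    (((f ≫ g).toOrderHom x : Fin (c + 1)) : ℕ) =
      ((g.toOrderHom (f.toOrderHom x) : Fin (c + 1)) : ℕ) := rfl

theorem hom_ext_val {a b : ℕ} {f g : SimplexCategory.mk a ⟶ SimplexCategory.mk b}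
    (h : ∀ x : Fin (a + 1), ((f.toOrderHom x : Fin (b + 1)) : ℕ) =
      ((g.toOrderHom x : Fin (b + 1)) : ℕ)) : f = g :=
  SimplexCategory.Hom.ext _ _ (OrderHom.ext _ _ (funext fun x => Fin.ext (h x)))

theorem map_comp_eq {a b b' c : ℕ} {f : SimplexCategory.mk a ⟶ SimplexCategory.mk b}
    {g : SimplexCategory.mk b ⟶ SimplexCategory.mk c}
    {f' : SimplexCategory.mk a ⟶ SimplexCategory.mk b'}
    {g' : SimplexCategory.mk b' ⟶ SimplexCategory.mk c} (h : f ≫ g = f' ≫ g')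
    (σ : Simplices S c) : S.map f.op (S.map g.op σ) = S.map f'.op (S.map g'.op σ) := by
  simpa using congrArg (fun f => S.map f.op σ) h

theorem map_comp_eq' {a b c : ℕ} {f : SimplexCategory.mk a ⟶ SimplexCategory.mk b}
    {g : SimplexCategory.mk b ⟶ SimplexCategory.mk c}
    {f' : SimplexCategory.mk a ⟶ SimplexCategory.mk c} (h : f ≫ g = f')
    (σ : Simplices S c) : S.map f.op (S.map g.op σ) = S.map f'.op σ := by
  simpa using congrArg (fun f => S.map f.op σ) h

theorem face_front_low {p n m : ℕ} (h : 0 + p ≤ n) (h' : 0 + (p + 1) ≤ n + 1) (hm : m < p + 2)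
    (hm' : m < n + 2) (σ : Simplices S (n + 1)) :
    face 0 p h (S.δ ⟨m, hm'⟩ σ) = S.δ ⟨m, hm⟩ (face 0 (p + 1) h' σ) := by
  refine map_comp_eq (hom_ext_val fun x => ?_) σ
  simp only [comp_val, delta_val, subinterval_val]
  split_ifs <;> lia

theorem face_front_high {p n m : ℕ} (h : 0 + p ≤ n) (h' : 0 + p ≤ n + 1) (hm : p + 1 ≤ m)
    (hm' : m < n + 2) (σ : Simplices S (n + 1)) :
    face 0 p h (S.δ ⟨m, hm'⟩ σ) = face 0 p h' σ := by
  refine map_comp_eq' (hom_ext_val fun x => ?_) σ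
  simp only [comp_val, delta_val, subinterval_val]
  have := x.2
  split_ifs <;> lia

theorem face_back_low {p q n m : ℕ} (h : p + q ≤ n) (h' : p + 1 + q ≤ n + 1) (hm : m ≤ p)
    (hm' : m < n + 2) (σ : Simplices S (n + 1)) :
    face p q h (S.δ ⟨m, hm'⟩ σ) = face (p + 1) q h' σ := by
  refine map_comp_eq' (hom_ext_val fun x => ?_) σ
  simp only [comp_val, delta_val, subinterval_val]
  split_ifs <;> lia

theorem face_back_high {p q n m : ℕ} (h : p + q ≤ n) (h' : p + (q + 1) ≤ n + 1) (hm : m < q + 2)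
    (hm' : p + m < n + 2) (σ : Simplices S (n + 1)) :
    face p q h (S.δ ⟨p + m, hm'⟩ σ) = S.δ ⟨m, hm⟩ (face p (q + 1) h' σ) := by
  refine map_comp_eq (hom_ext_val fun x => ?_) σ
  simp only [comp_val, delta_val, subinterval_val]
  split_ifs <;> lia

theorem face_face {a k b l n : ℕ} (h : a + k ≤ n) (h' : b + l ≤ k) (h'' : a + b + l ≤ n)
    (σ : Simplices S n) : face b l h' (face a k h σ) = face (a + b) l h'' σ := by
  refine map_comp_eq' (hom_ext_val fun x => ?_) σ
  simp only [comp_val, subinterval_val]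
  lia

theorem face_self {n : ℕ} (h : 0 + n ≤ n) (σ : Simplices S n) : face 0 n h σ = σ := by
  have : SimplexCategory.subinterval 0 n h = 𝟙 (SimplexCategory.mk n) :=
    hom_ext_val fun x => by rw [subinterval_val]; rfl
  simp [face, this]

/-- The Leibniz rule `δ(f ∪ g) = δf ∪ g + (-1)ⁱ f ∪ δg`. -/
theorem coboundary_cupCochain {i j n : ℕ} (h : i + j = n) (h₁ : i + 1 + j = n + 1)
    (h₂ : i + (j + 1) = n + 1) (f : Cochain R S i) (g : Cochain R S j) :
    coboundary R S n (cupCochain R S h f g) =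
      cupCochain R S h₁ (coboundary R S i f) g +
        (-1 : R) ^ i • cupCochain R S h₂ f (coboundary R S j g) := by
  funext σ
  let F : ℕ → R := fun m => if hm : m < n + 2 then
    (-1 : R) ^ m * cupCochain R S h f g (S.δ ⟨m, hm⟩ σ) else 0
  let P : ℕ → R := fun m => if hm : m < i + 2 then
    (-1 : R) ^ m * f (S.δ ⟨m, hm⟩ (face 0 (i + 1) (by lia) σ)) else 0
  let Q : ℕ → R := fun m => if hm : m < j + 2 then
    (-1 : R) ^ m * g (S.δ ⟨m, hm⟩ (face i (j + 1) (by lia) σ)) else 0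
  let a := f (face 0 i (by lia) σ)
  let b := g (face (i + 1) j (by lia) σ)
  have hF : coboundary R S n (cupCochain R S h f g) σ = ∑ m ∈ Finset.range (n + 2), F m := by
    rw [← Fin.sum_univ_eq_sum_range]
    refine Fintype.sum_congr _ _ fun (m : Fin (n + 2)) => ?_
    simp only [F]
    rw [dif_pos m.2]
  have hP : coboundary R S i f (face 0 (i + 1) (by lia) σ) =
      ∑ m ∈ Finset.range (i + 2), P m := by
    rw [← Fin.sum_univ_eq_sum_range]
    refine Fintype.sum_congr _ _ fun (m : Fin (i + 2)) => ?_
    simp only [P]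
    rw [dif_pos m.2]
  have hQ : coboundary R S j g (face i (j + 1) (by lia) σ) =
      ∑ m ∈ Finset.range (j + 2), Q m := by
    rw [← Fin.sum_univ_eq_sum_range]
    refine Fintype.sum_congr _ _ fun (m : Fin (j + 2)) => ?_
    simp only [Q]
    rw [dif_pos m.2]
  have hPF : ∀ m ∈ Finset.range (i + 1), F m = P m * b := by
    intro m hm
    have hm := Finset.mem_range.1 hm
    simp only [F, P, b]
    rw [dif_pos (by lia), dif_pos (by lia)]
    simp only [cupCochain, LinearMap.mk₂_apply]
    rw [face_front_low (by lia) (by lia) (by lia), face_back_low (by lia) (by lia) (by lia),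
      mul_assoc]
  have hQF : ∀ m ∈ Finset.range (j + 1), F (i + 1 + m) = (-1 : R) ^ i * (a * Q (m + 1)) := by
    intro m hm
    have hm := Finset.mem_range.1 hm
    have e : i + 1 + m = i + (m + 1) := by lia
    simp only [F, Q, a]
    rw [dif_pos (by lia), dif_pos (by lia)]
    simp only [cupCochain, LinearMap.mk₂_apply]
    rw [face_front_high (by lia) (by lia) (by lia)]
    simp only [e]
    rw [face_back_high (by lia) (by lia) (by lia)]
    ring
  have hPl : P (i + 1) = (-1 : R) ^ (i + 1) * a := by
    simp only [P, a]
    rw [dif_pos (by lia), ← face_front_low (n := n) (by lia) (by lia) (by lia) (by lia),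
      face_front_high (by lia) (by lia) (by lia)]
  have hQl : Q 0 = b := by
    simp only [Q, b]
    rw [dif_pos (by lia), ← face_back_high (n := n) (by lia) (by lia) (by lia) (by lia),
      face_back_low (by lia) (by lia) (by lia)]
    simp
  have hR : (cupCochain R S h₁ (coboundary R S i f) g +
        (-1 : R) ^ i • cupCochain R S h₂ f (coboundary R S j g)) σ =
      (∑ m ∈ Finset.range (i + 2), P m) * b +
        (-1 : R) ^ i * (a * ∑ m ∈ Finset.range (j + 2), Q m) := by
    rw [← hP, ← hQ]
    rfl
  rw [hF, hR, show n + 2 = i + 1 + (j + 1) by lia, Finset.sum_range_add,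
    Finset.sum_congr rfl hPF, Finset.sum_congr rfl hQF, Finset.sum_range_succ P (i + 1),
    Finset.sum_range_succ' Q (j + 1), hPl, hQl, ← Finset.sum_mul, ← Finset.mul_sum,
    ← Finset.mul_sum]
  ring

/-- The evaluation of a cochain on chains. -/
noncomputable def evalChain {k : ℕ} (f : Cochain R S k) : Chain R S k →ₗ[R] R := chainLift f

theorem evalChain_separates {k : ℕ} {c c' : Chain R S k}
    (h : ∀ f : Cochain R S k, evalChain f c = evalChain f c') : c = c' := by
  classical
  refine Finsupp.ext fun σ => ?_
  have key : ∀ c : Chain R S k, evalChain (Pi.single σ (1 : R)) c = (show Simplices S k →₀ R from c) σ := by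
    intro c
    refine (Finsupp.linearCombination_apply R c).trans ?_
    refine (Finset.sum_eq_single σ ?_ ?_).trans ?_
    · intro τ _ hτ
      simp [Pi.single_eq_of_ne hτ]
    · intro hσ
      simp [Finsupp.notMem_support_iff.1 hσ]
    · simp
  exact (key c).symm.trans ((h _).trans (key c'))

theorem evalChain_boundary {k : ℕ} (f : Cochain R S k) (c : Chain R S (k + 1)) :
    evalChain f (boundary R S k c) = evalChain (coboundary R S k f) c := by
  rw [← LinearMap.comp_apply]
  congr 1
  refine chain_hom_ext fun σ => ?_
  simp [evalChain, boundary, chainLift_simplexChain, coboundary]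

theorem evalChain_capChain {i j n : ℕ} (h : i + j = n) (f : Cochain R S i) (g : Cochain R S j)
    (c : Chain R S n) :
    evalChain g (capChain R S h f c) = evalChain (cupCochain R S h f g) c := by
  rw [← LinearMap.comp_apply]
  congr 1
  refine chain_hom_ext fun σ => ?_
  simp [evalChain, capChain, chainLift_simplexChain, cupCochain]

/-- `∂(f ∩ c) = (-1)ⁱ (f ∩ ∂c - δf ∩ c)`. -/
theorem boundary_capChain {i j n : ℕ} (h : i + j = n) (h₁ : i + 1 + j = n + 1)
    (h₂ : i + (j + 1) = n + 1) (f : Cochain R S i) (c : Chain R S (n + 1)) :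
    boundary R S j (capChain R S h₂ f c) =
      (-1 : R) ^ i • (capChain R S h f (boundary R S n c) -
        capChain R S h₁ (coboundary R S i f) c) := by
  refine evalChain_separates fun g => ?_
  rw [evalChain_boundary, evalChain_capChain, map_smul, map_sub, evalChain_capChain,
    evalChain_capChain, evalChain_boundary, coboundary_cupCochain h h₁ h₂]
  have e : ∀ f g : Cochain R S (n + 1), evalChain (f + g) c = evalChain f c + evalChain g c := by
    intro f g
    rw [← LinearMap.add_apply]
    congr 1
    exact chain_hom_ext fun σ => by simp [evalChain, chainLift_simplexChain]
  have e' : ∀ (a : R) (f : Cochain R S (n + 1)), evalChain (a • f) c = a * evalChain f c := by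
    intro a f
    rw [← smul_eq_mul, ← LinearMap.smul_apply]
    congr 1
    exact chain_hom_ext fun σ => by simp [evalChain, chainLift_simplexChain]
  rw [e, e', smul_eq_mul, add_sub_cancel_left, ← mul_assoc, ← mul_pow]
  simp

end Products

section Cohomology

variable (R : Type v) [CommRing R] (S : SSet.{u})

/-! ### Products in cohomology and homology -/

/-- The cup product of two cocycles, as a cocycle. -/
def cupCocycle {i j n : ℕ} (h : i + j = n) :
    cocycles R S i →ₗ[R] cocycles R S j →ₗ[R] cocycles R S n :=
  LinearMap.mk₂ R
    (fun f g => ⟨cupCochain R S h f.1 g.1, by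
      have hf : coboundary R S i f.1 = 0 := f.2
      have hg : coboundary R S j g.1 = 0 := g.2
      change coboundary R S n _ = 0
      rw [coboundary_cupCochain h (by lia) (by lia), hf, hg]
      simp⟩)
    (fun f f' g => Subtype.ext (LinearMap.map_add₂ _ _ _ _))
    (fun c f g => Subtype.ext (LinearMap.map_smul₂ _ _ _ _))
    (fun f g g' => Subtype.ext (map_add _ _ _))
    (fun c f g => Subtype.ext (map_smul _ _ _))

variable {R S} in
theorem cohomologyClass_eq_zero {k : ℕ} {f : cocycles R S k}
    (h : f.1 ∈ coboundaries R S k) : cohomologyClass R S k f = 0 :=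
  (Submodule.Quotient.mk_eq_zero _).2 h

variable {R S} in
theorem cupCocycle_coboundary_left {i j n : ℕ} (h : i + j = n) (f : cocycles R S i)
    (g : cocycles R S j) (hf : f.1 ∈ coboundaries R S i) :
    cohomologyClass R S n (cupCocycle R S h f g) = 0 := by
  refine cohomologyClass_eq_zero ?_
  change cupCochain R S h f.1 g.1 ∈ _
  cases i with
  | zero =>
    rw [show f.1 = 0 from hf]
    simp
  | succ i =>
    obtain ⟨e, he⟩ := hf
    obtain ⟨m, rfl⟩ : ∃ m, n = m + 1 := ⟨i + j, by lia⟩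
    refine ⟨cupCochain R S (show i + j = m by lia) e g.1, ?_⟩
    have hg : coboundary R S j g.1 = 0 := g.2
    rw [coboundary_cupCochain _ h (by lia), hg, he]
    simp

variable {R S} in
theorem cupCocycle_coboundary_right {i j n : ℕ} (h : i + j = n) (f : cocycles R S i)
    (g : cocycles R S j) (hg : g.1 ∈ coboundaries R S j) :
    cohomologyClass R S n (cupCocycle R S h f g) = 0 := by
  refine cohomologyClass_eq_zero ?_
  change cupCochain R S h f.1 g.1 ∈ _
  cases j with
  | zero =>
    rw [show g.1 = 0 from hg]
    simp
  | succ j =>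
    obtain ⟨e, he⟩ := hg
    obtain ⟨m, rfl⟩ : ∃ m, n = m + 1 := ⟨i + j, by lia⟩
    refine ⟨(-1 : R) ^ i • cupCochain R S (show i + j = m by lia) f.1 e, ?_⟩
    have hf : coboundary R S i f.1 = 0 := f.2
    rw [map_smul, coboundary_cupCochain _ (by lia) h, hf, he, smul_add, smul_smul, ← mul_pow]
    simp

/-- The cup product `Hⁱ × Hʲ → Hⁱ⁺ʲ`. -/
def cup {i j n : ℕ} (h : i + j = n) :
    Cohomology R S i →ₗ[R] Cohomology R S j →ₗ[R] Cohomology R S n :=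
  (Submodule.liftQ _ (Submodule.liftQ _
    ((cupCocycle R S h).compr₂ (cohomologyClass R S n))
    (fun f hf => LinearMap.ext fun g => cupCocycle_coboundary_left h f g hf)).flip
    (fun g hg => LinearMap.ext fun a => Submodule.Quotient.induction_on _ a fun f =>
      cupCocycle_coboundary_right h f g hg)).flip

theorem cup_cohomologyClass {i j n : ℕ} (h : i + j = n) (f : cocycles R S i)
    (g : cocycles R S j) :
    cup R S h (cohomologyClass R S i f) (cohomologyClass R S j g) =
      cohomologyClass R S n (cupCocycle R S h f g) := rfl

/-- The cap product of a cocycle and a cycle, as a cycle. -/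
noncomputable def capCycle {i j n : ℕ} (h : i + j = n) :
    cocycles R S i →ₗ[R] cycles R S n →ₗ[R] cycles R S j :=
  LinearMap.mk₂ R
    (fun f c => ⟨capChain R S h f.1 c.1, by
      cases j with
      | zero => exact Submodule.mem_top
      | succ j =>
        obtain ⟨m, rfl⟩ : ∃ m, n = m + 1 := ⟨i + j, by lia⟩
        have hf : coboundary R S i f.1 = 0 := f.2
        have hc : boundary R S m c.1 = 0 := c.2
        change boundary R S j _ = 0
        rw [boundary_capChain (show i + j = m by lia) (by lia), hf, hc]
        simp⟩)
    (fun f f' g => Subtype.ext (LinearMap.map_add₂ _ _ _ _))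
    (fun c f g => Subtype.ext (LinearMap.map_smul₂ _ _ _ _))
    (fun f g g' => Subtype.ext (map_add _ _ _))
    (fun c f g => Subtype.ext (map_smul _ _ _))

variable {R S} in
theorem homologyClass_eq_zero {k : ℕ} {c : cycles R S k}
    (h : c.1 ∈ boundaries R S k) : homologyClass R S k c = 0 :=
  (Submodule.Quotient.mk_eq_zero _).2 h

variable {R S} in
theorem capCycle_coboundary {i j n : ℕ} (h : i + j = n) (f : cocycles R S i)
    (c : cycles R S n) (hf : f.1 ∈ coboundaries R S i) :
    homologyClass R S j (capCycle R S h f c) = 0 := by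
  refine homologyClass_eq_zero ?_
  change capChain R S h f.1 c.1 ∈ _
  cases i with
  | zero =>
    rw [show f.1 = 0 from hf]
    simp
  | succ i =>
    obtain ⟨e, he⟩ := hf
    obtain ⟨m, rfl⟩ : ∃ m, n = m + 1 := ⟨i + j, by lia⟩
    have hc : boundary R S m c.1 = 0 := c.2
    refine ⟨-((-1 : R) ^ i • capChain R S (show i + (j + 1) = m + 1 by lia) e c.1), ?_⟩
    rw [map_neg, map_smul, boundary_capChain (show i + j = m by lia) h, hc, he, smul_smul,
      ← mul_pow]
    simp

variable {R S} in
theorem capCycle_boundary {i j n : ℕ} (h : i + j = n) (f : cocycles R S i)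
    (c : cycles R S n) (hc : c.1 ∈ boundaries R S n) :
    homologyClass R S j (capCycle R S h f c) = 0 := by
  refine homologyClass_eq_zero ?_
  change capChain R S h f.1 c.1 ∈ _
  obtain ⟨e, he⟩ := hc
  have hf : coboundary R S i f.1 = 0 := f.2
  refine ⟨(-1 : R) ^ i • capChain R S (show i + (j + 1) = n + 1 by lia) f.1 e, ?_⟩
  rw [map_smul, boundary_capChain h (by lia), hf, he, smul_smul, ← mul_pow]
  simp

/-- The cap product `Hⁱ × Hᵢ₊ⱼ → Hⱼ`. -/
noncomputable def cap {i j n : ℕ} (h : i + j = n) :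
    Cohomology R S i →ₗ[R] Homology R S n →ₗ[R] Homology R S j :=
  (Submodule.liftQ _ (Submodule.liftQ _
    ((capCycle R S h).compr₂ (homologyClass R S j))
    (fun f hf => LinearMap.ext fun c => capCycle_coboundary h f c hf)).flip
    (fun c hc => LinearMap.ext fun a => Submodule.Quotient.induction_on _ a fun f =>
      capCycle_boundary h f c hc)).flip

theorem cap_homologyClass {i j n : ℕ} (h : i + j = n) (f : cocycles R S i)
    (c : cycles R S n) :
    cap R S h (cohomologyClass R S i f) (homologyClass R S n c) =
      homologyClass R S j (capCycle R S h f c) := rfl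

/-! ### The cohomology ring -/

/-- The unit of the cohomology ring: the class of the constant `0`-cochain `1`. -/
def cohomologyOne : Cohomology R S 0 :=
  cohomologyClass R S 0 ⟨fun _ => 1, by
    change coboundary R S 0 _ = 0
    funext σ
    simp [coboundary, Fin.sum_univ_two]⟩

variable {R S} in
theorem cohomologyOne_cup {i : ℕ} (h : 0 + i = i) (a : Cohomology R S i) :
    cup R S h (cohomologyOne R S) a = a := by
  refine Submodule.Quotient.induction_on _ a fun f => ?_
  refine congrArg (cohomologyClass R S i) (Subtype.ext (funext fun σ => ?_))
  change 1 * f.1 (face 0 i _ σ) = f.1 σ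
  rw [one_mul, face_self]

variable {R S} in
theorem cup_cohomologyOne {i : ℕ} (h : i + 0 = i) (a : Cohomology R S i) :
    cup R S h a (cohomologyOne R S) = a := by
  refine Submodule.Quotient.induction_on _ a fun f => ?_
  refine congrArg (cohomologyClass R S i) (Subtype.ext (funext fun σ => ?_))
  change f.1 (face 0 i _ σ) * 1 = f.1 σ
  rw [mul_one, face_self]

variable {R S} in
theorem cup_assoc {i j k p q n : ℕ} (h₁ : i + j = p) (h₂ : p + k = n) (h₃ : j + k = q)
    (h₄ : i + q = n) (a : Cohomology R S i) (b : Cohomology R S j) (c : Cohomology R S k) :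
    cup R S h₂ (cup R S h₁ a b) c = cup R S h₄ a (cup R S h₃ b c) := by
  refine Submodule.Quotient.induction_on _ a fun f => ?_
  refine Submodule.Quotient.induction_on _ b fun g => ?_
  refine Submodule.Quotient.induction_on _ c fun e => ?_
  refine congrArg (cohomologyClass R S n) (Subtype.ext (funext fun σ => ?_))
  subst h₁ h₃
  change f.1 (face 0 i _ (face 0 (i + j) _ σ)) * g.1 (face i j _ (face 0 (i + j) _ σ)) *
      e.1 (face (i + j) k _ σ) =
    f.1 (face 0 i _ σ) * (g.1 (face 0 j _ (face i (j + k) _ σ)) *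
      e.1 (face j k _ (face i (j + k) _ σ)))
  rw [face_face _ _ (by lia), face_face _ _ (by lia), face_face _ _ (by lia),
    face_face _ _ (by lia), mul_assoc]
  simp only [zero_add, add_zero]

variable {R S} in
theorem sigma_cup_eq {i j n n' : ℕ} (h : i + j = n) (h' : i + j = n') (a : Cohomology R S i)
    (b : Cohomology R S j) :
    (GradedMonoid.mk n (cup R S h a b) : GradedMonoid (Cohomology R S)) =
      GradedMonoid.mk n' (cup R S h' a b) := by
  subst h
  subst h'
  rfl

instance : GradedMonoid.GOne (Cohomology R S) := ⟨cohomologyOne R S⟩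

instance : GradedMonoid.GMul (Cohomology R S) := ⟨fun a b => cup R S rfl a b⟩

instance : GradedMonoid.GMonoid (Cohomology R S) where
  one_mul a := (sigma_cup_eq rfl (zero_add _) _ _).trans
    (congrArg (GradedMonoid.mk _) (cohomologyOne_cup _ a.2))
  mul_one a := (sigma_cup_eq rfl (add_zero _) _ _).trans
    (congrArg (GradedMonoid.mk _) (cup_cohomologyOne _ a.2))
  mul_assoc a b c := (congrArg (GradedMonoid.mk _)
    (cup_assoc rfl rfl rfl (add_assoc _ _ _).symm a.2 b.2 c.2)).trans
    (sigma_cup_eq _ rfl _ _)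

/-- The cup product makes the cohomology groups the components of a graded ring; the instance
`DirectSum.ring` then makes `⨁ k, Hᵏ` a ring. -/
instance : DirectSum.GRing (Cohomology R S) where
  mul_zero a := map_zero (cup R S rfl a)
  zero_mul b := LinearMap.map_zero₂ (cup R S rfl) b
  mul_add a b c := map_add (cup R S rfl a) b c
  add_mul a b c := LinearMap.map_add₂ (cup R S rfl) a b c
  natCast n := n • cohomologyOne R S
  natCast_zero := zero_smul ℕ _
  natCast_succ _ := succ_nsmul _ _
  intCast n := n • cohomologyOne R S
  intCast_ofNat _ := natCast_zsmul _ _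
  intCast_negSucc_ofNat _ := negSucc_zsmul _ _

end Cohomology

section Space

/-! ### Topological spaces -/

open DirectSum

variable (R : Type v) [CommRing R] (X : Type u) [TopologicalSpace X]

/-- The singular simplicial set of a topological space. -/
noncomputable abbrev Sing : SSet.{u} := TopCat.toSSet.obj (TopCat.of X)

/-- The singular cohomology ring `H*(X; R) = ⨁ₖ Hᵏ(X; R)`, with the cup product. -/
abbrev CohomologyRing : Type (max u v) := ⨁ k, Cohomology R (Sing X) k

variable {R X} in
/-- A class in `Hᵏ(X; R)`, considered as a homogeneous element of the cohomology ring. -/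
noncomputable def homogeneous {k : ℕ} (x : Cohomology R (Sing X) k) : CohomologyRing R X :=
  DirectSum.of (Cohomology R (Sing X)) k x

/-- The cup-length of `X` over `R`: the supremum of all `c` for which there are `c` cohomology
classes of positive degrees whose cup product is nonzero. -/
noncomputable def cupLength : ℕ∞ :=
  sSup {c : ℕ∞ | ∃ (m : ℕ) (d : Fin m → ℕ) (a : (i : Fin m) → Cohomology R (Sing X) (d i)),
    (∀ i, 0 < d i) ∧ (List.ofFn fun i => homogeneous (a i)).prod ≠ 0 ∧ c = m}

variable {R X} in
/-- The height of a cohomology class `x`: the supremum of all `m` such that `xᵐ ≠ 0`. -/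
noncomputable def height {k : ℕ} (x : Cohomology R (Sing X) k) : ℕ∞ :=
  sSup {c : ℕ∞ | ∃ m : ℕ, homogeneous x ^ m ≠ 0 ∧ c = m}

/-- `X` is an `R`-Poincaré space of formal dimension `n`: it is path-connected and there is
`μ ∈ H_n(X; R) ≅ R` such that `x ↦ x ∩ μ` is an isomorphism from `Hᵏ(X; R)` to `H_{n-k}(X; R)`
for each integer `k`. Groups in negative degrees are zero, so that this says for `k > n` that
`Hᵏ(X; R) = 0` and for `k < 0` that `H_{n-k}(X; R) = 0`. -/
structure IsPoincareSpace (n : ℕ) : Prop where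
  pathConnected : PathConnectedSpace X
  duality : ∃ μ : Homology R (Sing X) n, Nonempty (Homology R (Sing X) n ≃ₗ[R] R) ∧
    ∀ (i j : ℕ) (h : i + j = n),
      Function.Bijective fun x : Cohomology R (Sing X) i => cap R (Sing X) h x μ
  cohomology_vanishing : ∀ i : ℕ, n < i → Subsingleton (Cohomology R (Sing X) i)
  homology_vanishing : ∀ i : ℕ, n < i → Subsingleton (Homology R (Sing X) i)

end Space

end SingularTheory

open SingularTheory

/-!
The first degree `r` is positive because `0`-cocycles on a path-connected space are constant. The
rest compares degrees in nonzero products of homogeneous classes.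

* Every factor of a nonzero product has degree at least `r`, and the total degree is at most `n`;
  hence `cup(X) ≤ n / r`. A class of degree `r` and height `n / r` attains this bound.
* Over a field, duality makes the pairing `Hⁱ × Hⁿ⁻ⁱ → Hⁿ` nondegenerate (`exists_cup_ne_zero`):
  a nonzero class `y` of degree `i` is given by a cocycle whose cap product with the fundamental
  cycle is not a boundary, and a linear functional that vanishes on boundaries but not on this
  cycle is a cocycle pairing nontrivially with `y`. So a nonzero product of degree less than `n`
  has room for one more factor of positive degree.
* If `a(1), …, a(t)` is a basis of `Hʳ` with `a(i) ^ (kᵢ + 1) = 0`, then a nonzero product contains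
  at most `K = ∑ kᵢ` factors of degree `r` (`countP_degree_le`): collect these factors, expand them
  in the basis, and sort a nonzero monomial into powers of the `a(i)`. The other factors have
  degree at least `q`, so a product of `c` classes satisfies `q c ≤ n + (q - r) K`, which is the
  bound `c ≤ K + ⌊(n - r K) / q⌋`.

Sorting the factors needs graded commutativity of the cup product (`cup_comm`). Reversing the
vertices of all simplices, with the sign `(-1)^(k(k+1)/2)` in degree `k`, turns `f ∪ g` into
`(-1)^(ij) g ∪ f` already on cochains, so it is enough that this reversal is homotopic to the
identity. Since a singular simplex can be precomposed with the affine map given by an arbitrary map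
of vertices, a cochain can be evaluated, on a fixed simplex, on all words in its vertices, and the
homotopy is constructed once and for all for functions on words, by recursion on the length
(`wordHomotopy_wordCoboundary`).
-/

namespace SingularTheory

open CategoryTheory Opposite

/-! ### Functions on words of vertices -/

section Words

variable {R V W : Type*} [CommRing R]

/-- The coboundary `(dF)(w) = ∑ᵢ (-1)ⁱ F(w without its i-th letter)` of a function on words,
defined by recursion on the first letter. -/
def wordCoboundary : (List V → R) → List V → R
  | _, [] => 0
  | F, v :: w => F w - wordCoboundary (fun u => F (v :: u)) w

/-- The sign `(-1)^(m(m-1)/2)` of the permutation reversing `m` letters. -/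
def reversalSign (R : Type*) [CommRing R] (m : ℕ) : R := (-1) ^ m.choose 2

/-- The function `w ↦ ± F(w reversed)` on words, with the sign of the reversing permutation. -/
def wordReversal (F : List V → R) (w : List V) : R := reversalSign R w.length * F w.reverse

/-- The dual of the homotopy `P(vw) = v ρ(vw) - v P(w)` from the identity to the signed
reversal `ρ` of words. Unfolding the recursion gives the prism operator
`P(v₀ … vₙ) = ∑ᵢ ± v₀ … vᵢ vₙ … vᵢ`. -/
def wordHomotopy : (List V → R) → List V → R
  | _, [] => 0
  | F, v :: w => wordReversal (fun u => F (v :: u)) (v :: w) - wordHomotopy (fun u => F (v :: u)) w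

theorem reversalSign_succ (m : ℕ) : reversalSign R (m + 1) = (-1) ^ m * reversalSign R m := by
  rw [reversalSign, reversalSign, ← pow_add, Nat.choose_succ_succ' m 1, Nat.choose_one_right]

theorem wordCoboundary_sub (F G : List V → R) (w : List V) :
    wordCoboundary (fun u => F u - G u) w = wordCoboundary F w - wordCoboundary G w := by
  induction w generalizing F G with
  | nil => simp [wordCoboundary]
  | cons v w ih => simp only [wordCoboundary, ih]; ring

theorem wordHomotopy_sub (F G : List V → R) (w : List V) :
    wordHomotopy (fun u => F u - G u) w = wordHomotopy F w - wordHomotopy G w := by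
  induction w generalizing F G with
  | nil => simp [wordHomotopy]
  | cons v w ih => simp only [wordHomotopy, wordReversal, ih]; ring

theorem wordHomotopy_zero (w : List V) : wordHomotopy (fun _ => (0 : R)) w = 0 := by
  simpa using wordHomotopy_sub (fun _ => (0 : R)) (fun _ => 0) w

theorem wordHomotopy_map (f : V → W) (F : List W → R) (w : List V) :
    wordHomotopy (fun u => F (u.map f)) w = wordHomotopy F (w.map f) := by
  induction w generalizing F with
  | nil => rfl
  | cons v w ih =>
    simp only [wordHomotopy, wordReversal, List.map_cons, List.length_cons, List.length_map,
      List.reverse_cons, List.map_append, List.map_reverse, List.map_nil]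
    rw [← ih (fun u => F (f v :: u))]

theorem wordCoboundary_eq_sum (F : List V → R) (w : List V) :
    wordCoboundary F w = ∑ i ∈ Finset.range w.length, (-1) ^ i * F (w.eraseIdx i) := by
  induction w generalizing F with
  | nil => rfl
  | cons v w ih =>
    rw [wordCoboundary, ih, List.length_cons, Finset.sum_range_succ', sub_eq_neg_add,
      ← Finset.sum_neg_distrib]
    simp [pow_succ]

theorem wordCoboundary_wordCoboundary (F : List V → R) (w : List V) :
    wordCoboundary (wordCoboundary F) w = 0 := by
  induction w generalizing F with
  | nil => rfl
  | cons v w ih =>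
    rw [wordCoboundary]
    simp only [wordCoboundary]
    rw [wordCoboundary_sub F, ih, sub_zero, sub_self]

theorem wordCoboundary_append (F : List V → R) (w : List V) (v : V) :
    wordCoboundary F (w ++ [v]) =
      wordCoboundary (fun u => F (u ++ [v])) w + (-1) ^ w.length * F w := by
  induction w generalizing F with
  | nil => simp [wordCoboundary]
  | cons a w ih =>
    simp only [List.cons_append, wordCoboundary, ih, List.length_cons]
    ring

theorem wordCoboundary_sign (F : List V → R) (w : List V) :
    wordCoboundary (fun u => (-1) ^ u.length * F u) w =
      -((-1) ^ w.length * wordCoboundary F w) := by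
  induction w generalizing F with
  | nil => simp [wordCoboundary]
  | cons a w ih =>
    have := ih fun u => -F (a :: u)
    have h := wordCoboundary_sub (fun _ => (0 : R)) (fun u => F (a :: u)) w
    have h0 : wordCoboundary (fun _ => (0 : R)) w = 0 := by
      simpa using wordCoboundary_sub (fun _ => (0 : R)) (fun _ => 0) w
    simp only [zero_sub, h0] at h
    simp only [wordCoboundary, List.length_cons, pow_succ, mul_assoc, neg_mul, one_mul]
    rw [this, h]
    ring

/-- The signed reversal commutes with the coboundary. -/
theorem wordCoboundary_wordReversal (F : List V → R) (w : List V) :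
    wordCoboundary (wordReversal F) w = wordReversal (wordCoboundary F) w := by
  induction w generalizing F with
  | nil => simp [wordReversal, wordCoboundary]
  | cons v w ih =>
    have e : (fun u => wordReversal F (v :: u)) =
        fun u => (-1) ^ u.length * wordReversal (fun u => F (u ++ [v])) u := by
      funext u
      simp only [wordReversal, List.length_cons, List.reverse_cons, reversalSign_succ, mul_assoc]
    have s : ((-1 : R) ^ w.length) * (-1) ^ w.length = 1 := by rw [← mul_pow]; simp
    rw [wordCoboundary, e, wordCoboundary_sign, ih, wordReversal, wordReversal, wordReversal,
      List.length_cons, List.reverse_cons, wordCoboundary_append, reversalSign_succ,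
      List.length_reverse]
    linear_combination (-reversalSign R w.length * F w.reverse) * s

/-- `h ∘ d + d ∘ h = ρ - 1` for the signed reversal `ρ`. -/
theorem wordHomotopy_wordCoboundary (F : List V → R) (w : List V) :
    wordHomotopy (wordCoboundary F) w + wordCoboundary (wordHomotopy F) w =
      wordReversal F w - F w := by
  induction w generalizing F with
  | nil => simp [wordHomotopy, wordCoboundary, wordReversal, reversalSign]
  | cons v w ih =>
    have h₁ := ih fun u => F (v :: u)
    have h₂ := wordCoboundary_wordReversal (fun u => F (v :: u)) (v :: w)
    rw [wordCoboundary] at h₂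
    rw [wordHomotopy, wordCoboundary]
    simp only [wordHomotopy, wordCoboundary]
    rw [wordHomotopy_sub F, wordCoboundary_sub (fun u => wordReversal (fun u => F (v :: u)) (v :: u))]
    simp only [wordReversal] at *
    linear_combination h₁ + h₂

end Words

/-! ### Graded commutativity of the cup product -/

section Commutativity

variable {R : Type*} [CommRing R] {X : Type*} [TopologicalSpace X]

/-- The singular simplex `σ ∘ |u|`, for an arbitrary map `u` of vertices: the singular simplicial
set of a space carries an action of all maps of vertices, not only of the monotone ones. -/
noncomputable def vertexPullback {m n : ℕ} (u : Fin (m + 1) → Fin (n + 1))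
    (σ : Simplices (Sing X) n) : Simplices (Sing X) m :=
  (TopCat.toSSetObjEquiv (TopCat.of X) (op (SimplexCategory.mk m))).symm
    ((TopCat.toSSetObjEquiv (TopCat.of X) (op (SimplexCategory.mk n)) σ).comp
      ⟨stdSimplex.map u, stdSimplex.continuous_map u⟩)

theorem vertexPullback_vertexPullback {l m n : ℕ} (u : Fin (l + 1) → Fin (m + 1))
    (v : Fin (m + 1) → Fin (n + 1)) (σ : Simplices (Sing X) n) :
    vertexPullback u (vertexPullback v σ) = vertexPullback (v ∘ u) σ := by
  refine (TopCat.toSSetObjEquiv _ _).injective ?_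
  simp only [vertexPullback, Equiv.apply_symm_apply]
  ext x
  simp only [ContinuousMap.comp_apply, ContinuousMap.coe_mk]
  rw [stdSimplex.map_comp_apply]

theorem vertexPullback_id {n : ℕ} (σ : Simplices (Sing X) n) : vertexPullback id σ = σ := by
  refine (TopCat.toSSetObjEquiv _ _).injective ?_
  simp only [vertexPullback, Equiv.apply_symm_apply]
  ext x
  simp only [ContinuousMap.comp_apply, ContinuousMap.coe_mk]
  rw [stdSimplex.map_id_apply]

theorem map_op_eq_vertexPullback {m n : ℕ} (θ : SimplexCategory.mk m ⟶ SimplexCategory.mk n)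
    (σ : Simplices (Sing X) n) :
    (Sing X).map θ.op σ = vertexPullback (fun x => θ.toOrderHom x) σ := rfl

theorem delta_eq_vertexPullback {n : ℕ} (i : Fin (n + 2)) (σ : Simplices (Sing X) (n + 1)) :
    (Sing X).δ i σ = vertexPullback i.succAbove σ := rfl

/-- The value of a singular cochain `f` on the words in the vertices of a simplex `σ`: a word
with `k + 1` letters is the singular `k`-simplex obtained from `σ` by the corresponding map of
vertices; `f` is taken to vanish on words of any other length. -/
noncomputable def wordValue {k n : ℕ} (f : Cochain R (Sing X) k) (σ : Simplices (Sing X) n)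
    (w : List (Fin (n + 1))) : R :=
  if w.length = k + 1 then f (vertexPullback (fun x => w.getD x 0) σ) else 0

theorem wordValue_of_length {k n : ℕ} (f : Cochain R (Sing X) k) (σ : Simplices (Sing X) n)
    {w : List (Fin (n + 1))} (h : w.length = k + 1) :
    wordValue f σ w = f (vertexPullback (fun x => w.getD x 0) σ) := if_pos h

theorem wordValue_vertexPullback {k m n : ℕ} (f : Cochain R (Sing X) k)
    (u : Fin (m + 1) → Fin (n + 1)) (σ : Simplices (Sing X) n) (w : List (Fin (m + 1))) :
    wordValue f (vertexPullback u σ) w = wordValue f σ (w.map u) := by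
  unfold wordValue
  rw [List.length_map]
  split_ifs with h
  · rw [vertexPullback_vertexPullback]
    congr 2
    funext x
    have hx : (x : ℕ) < w.length := by have := x.2; lia
    simp [hx]
  · rfl

/-- On words, the coboundary of cochains is the coboundary of functions. -/
theorem wordCoboundary_wordValue {k n : ℕ} (f : Cochain R (Sing X) k)
    (σ : Simplices (Sing X) n) :
    wordCoboundary (wordValue f σ) = wordValue (coboundary R (Sing X) k f) σ := by
  funext w
  rw [wordCoboundary_eq_sum]
  by_cases h : w.length = k + 2
  · rw [wordValue_of_length _ _ (show w.length = k + 1 + 1 from h), h,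
      ← Fin.sum_univ_eq_sum_range (fun i => (-1) ^ i * wordValue f σ (w.eraseIdx i))]
    refine Fintype.sum_congr _ _ fun i => ?_
    have hi : (i : ℕ) < w.length := by have := i.2; lia
    rw [wordValue_of_length _ _ (by rw [List.length_eraseIdx_of_lt hi]; lia),
      delta_eq_vertexPullback, vertexPullback_vertexPullback]
    congr 3
    funext x
    have hx := x.2
    simp only [Function.comp_apply, Fin.succAbove, Fin.lt_def, Fin.val_castSucc]
    split_ifs with hxi
    · simp [List.getD_eq_getElem?_getD, List.getElem?_eraseIdx, hxi]
    · simp [List.getD_eq_getElem?_getD, List.getElem?_eraseIdx, hxi]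
  · rw [wordValue, if_neg (by lia)]
    refine Finset.sum_eq_zero fun i hi => ?_
    rw [wordValue, if_neg, mul_zero]
    rw [List.length_eraseIdx_of_lt (Finset.mem_range.1 hi)]
    have := Finset.mem_range.1 hi
    lia

theorem wordValue_finRange {k : ℕ} (f : Cochain R (Sing X) k) (σ : Simplices (Sing X) k) :
    wordValue f σ (List.finRange (k + 1)) = f σ := by
  rw [wordValue_of_length _ _ (List.length_finRange), ← congrArg f (vertexPullback_id σ)]
  congr 2
  funext x
  have hx : (x : ℕ) ≤ k := Nat.lt_succ_iff.1 x.2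
  rw [List.getD_eq_getElem _ _ (by simpa using hx)]
  simp

/-- The cochain `f` with the vertices of all simplices reversed, with the sign of the reversing
permutation. -/
noncomputable def reverseCochain {k : ℕ} (f : Cochain R (Sing X) k) : Cochain R (Sing X) k :=
  fun σ => reversalSign R (k + 1) * f (vertexPullback Fin.rev σ)

theorem wordReversal_wordValue {k : ℕ} (f : Cochain R (Sing X) k) (σ : Simplices (Sing X) k) :
    wordReversal (wordValue f σ) (List.finRange (k + 1)) = reverseCochain f σ := by
  rw [wordReversal, reverseCochain, List.length_finRange,
    wordValue_of_length _ _ (by rw [List.length_reverse, List.length_finRange])]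
  congr 3
  funext x
  have hx : (x : ℕ) ≤ k := Nat.lt_succ_iff.1 x.2
  rw [List.getD_eq_getElem _ _ (by simpa using hx)]
  simp [Fin.ext_iff, Fin.val_rev]

theorem map_succAbove_finRange {n : ℕ} (i : Fin (n + 1)) :
    (List.finRange n).map i.succAbove = (List.finRange (n + 1)).eraseIdx i := by
  have hi : (i : ℕ) ≤ n := Nat.lt_succ_iff.1 i.2
  refine List.ext_getElem (by simp [List.length_eraseIdx, hi]) fun x h₁ h₂ => ?_
  rw [List.getElem_eraseIdx]
  simp only [List.getElem_map, List.getElem_finRange, Fin.succAbove, Fin.lt_def,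
    Fin.ext_iff]
  split_ifs <;> simp_all

theorem coboundary_coboundary {k : ℕ} (f : Cochain R (Sing X) k) :
    coboundary R (Sing X) (k + 1) (coboundary R (Sing X) k f) = 0 := by
  funext σ
  rw [← wordValue_finRange (coboundary R (Sing X) (k + 1) _), ← wordCoboundary_wordValue,
    ← wordCoboundary_wordValue, wordCoboundary_wordCoboundary]
  rfl

/-- Reversing the vertices does not change the cohomology class of a cocycle. -/
theorem reverseCochain_sub_mem {k : ℕ} (f : Cochain R (Sing X) k)
    (hf : f ∈ cocycles R (Sing X) k) :
    reverseCochain f - f ∈ coboundaries R (Sing X) k := by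
  have hf : coboundary R (Sing X) k f = 0 := hf
  have key : ∀ σ, (reverseCochain f - f) σ =
      wordCoboundary (wordHomotopy (wordValue f σ)) (List.finRange (k + 1)) := by
    intro σ
    have h := wordHomotopy_wordCoboundary (wordValue f σ) (List.finRange (k + 1))
    have h0 : wordValue (0 : Cochain R (Sing X) (k + 1)) σ = fun _ => 0 := by
      funext w
      simp [wordValue]
    rw [wordReversal_wordValue, wordValue_finRange, wordCoboundary_wordValue, hf, h0,
      wordHomotopy_zero, zero_add] at h
    exact h.symm
  cases k with
  | zero =>
    -- words with one letter: the homotopy is evaluated on the empty word, where it vanishes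
    change _ = _
    funext σ
    rw [key]
    simp [List.finRange_succ, wordCoboundary, wordHomotopy]
  | succ k =>
    refine ⟨fun σ => wordHomotopy (wordValue f σ) (List.finRange (k + 1)), ?_⟩
    funext σ
    change ∑ i : Fin (k + 2), (-1 : R) ^ (i : ℕ) *
      wordHomotopy (wordValue f ((Sing X).δ i σ)) (List.finRange (k + 1)) = _
    rw [key, wordCoboundary_eq_sum, List.length_finRange,
      ← Fin.sum_univ_eq_sum_range
        (fun i => (-1) ^ i * wordHomotopy (wordValue f σ) ((List.finRange (k + 1 + 1)).eraseIdx i))]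
    refine Fintype.sum_congr _ _ fun i => ?_
    rw [delta_eq_vertexPullback, ← map_succAbove_finRange, ← wordHomotopy_map,
      funext (wordValue_vertexPullback f i.succAbove σ)]

theorem reverseCochain_mem_cocycles {k : ℕ} {f : Cochain R (Sing X) k}
    (hf : f ∈ cocycles R (Sing X) k) : reverseCochain f ∈ cocycles R (Sing X) k := by
  have h : reverseCochain f - f ∈ cocycles R (Sing X) k := by
    have := reverseCochain_sub_mem f hf
    cases k with
    | zero =>
      rw [show reverseCochain f - f = 0 from this]
      exact zero_mem _
    | succ k =>
      obtain ⟨e, he⟩ := this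
      rw [← he]
      exact coboundary_coboundary e
  simpa using add_mem h hf

theorem cohomologyClass_reverseCochain {k : ℕ} (f : cocycles R (Sing X) k) :
    cohomologyClass R (Sing X) k ⟨reverseCochain f.1, reverseCochain_mem_cocycles f.2⟩ =
      cohomologyClass R (Sing X) k f := by
  rw [← sub_eq_zero, ← map_sub]
  exact cohomologyClass_eq_zero (reverseCochain_sub_mem f.1 f.2)

theorem reversalSign_add (i j : ℕ) :
    reversalSign R (i + 1) * reversalSign R (j + 1) =
      (-1) ^ (i * j) * reversalSign R (i + j + 1) := by
  induction j with
  | zero => simp [reversalSign]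
  | succ j ih =>
    rw [reversalSign_succ (j + 1), mul_left_comm, ih, ← add_assoc, reversalSign_succ (i + j + 1),
      ← mul_assoc, ← mul_assoc, ← pow_add, ← pow_add]
    congr 1
    rw [show i * (j + 1) + (i + j + 1) = j + 1 + i * j + (i + i) by ring, pow_add _ _ (i + i),
      ← two_mul, pow_mul (-1 : R) 2 i]
    simp

/-- Reversal of vertices is an anti-automorphism, up to the sign of graded commutativity. -/
theorem cupCochain_reverseCochain {i j n : ℕ} (h : i + j = n) (h' : j + i = n)
    (f : Cochain R (Sing X) i) (g : Cochain R (Sing X) j) :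
    cupCochain R (Sing X) h (reverseCochain f) (reverseCochain g) =
      (-1 : R) ^ (i * j) • reverseCochain (cupCochain R (Sing X) h' g f) := by
  funext σ
  have e₁ : face 0 j (by lia) (vertexPullback Fin.rev σ) =
      vertexPullback Fin.rev (face i j (by lia) σ) := by
    rw [face, face, map_op_eq_vertexPullback, map_op_eq_vertexPullback,
      vertexPullback_vertexPullback, vertexPullback_vertexPullback]
    congr 1
    funext x
    refine Fin.ext ?_
    have hx := x.2
    simp only [Function.comp_apply, Fin.val_rev, subinterval_val]
    lia
  have e₂ : face j i (by lia) (vertexPullback Fin.rev σ) =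
      vertexPullback Fin.rev (face 0 i (by lia) σ) := by
    rw [face, face, map_op_eq_vertexPullback, map_op_eq_vertexPullback,
      vertexPullback_vertexPullback, vertexPullback_vertexPullback]
    congr 1
    funext x
    refine Fin.ext ?_
    have hx := x.2
    simp only [Function.comp_apply, Fin.val_rev, subinterval_val]
    lia
  simp only [cupCochain, LinearMap.mk₂_apply, reverseCochain, Pi.smul_apply, smul_eq_mul]
  have s : (-1 : R) ^ (i * j) * reversalSign R (n + 1) =
      reversalSign R (i + 1) * reversalSign R (j + 1) := by
    rw [← h, reversalSign_add]
  rw [e₁, e₂, ← mul_assoc ((-1) ^ (i * j)), s]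
  ring

/-- The cup product in singular cohomology is graded commutative. -/
theorem cup_comm {i j n : ℕ} (h : i + j = n) (h' : j + i = n) (a : Cohomology R (Sing X) i)
    (b : Cohomology R (Sing X) j) :
    cup R (Sing X) h a b = (-1 : R) ^ (i * j) • cup R (Sing X) h' b a := by
  refine Submodule.Quotient.induction_on _ a fun f => ?_
  refine Submodule.Quotient.induction_on _ b fun g => ?_
  change cup R (Sing X) h (cohomologyClass R (Sing X) i f) (cohomologyClass R (Sing X) j g) =
    (-1 : R) ^ (i * j) • cohomologyClass R (Sing X) n (cupCocycle R (Sing X) h' g f)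
  rw [← cohomologyClass_reverseCochain f, ← cohomologyClass_reverseCochain g,
    cup_cohomologyClass, ← cohomologyClass_reverseCochain (cupCocycle R (Sing X) h' g f),
    ← map_smul]
  exact congrArg _ (Subtype.ext (cupCochain_reverseCochain h h' f.1 g.1))

end Commutativity

/-! ### Degree zero and Poincaré duality -/

/-- On a path-connected space every `0`-cocycle is constant. -/
theorem subsingleton_reducedCohomology_zero {R : Type*} [CommRing R] {X : Type*}
    [TopologicalSpace X] [PathConnectedSpace X] :
    Subsingleton (ReducedCohomology R (Sing X) 0) := by
  refine ⟨fun a b => ?_⟩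
  suffices h : ∀ a : ReducedCohomology R (Sing X) 0, a = 0 by rw [h a, h b]
  intro a
  refine Submodule.Quotient.induction_on _ a fun f => ?_
  refine (Submodule.Quotient.mk_eq_zero _).2 ?_
  change f.1 ∈ Submodule.span R {fun _ => 1}
  let σ₀ : X → Simplices (Sing X) 0 := (TopCat.toSSetObj₀Equiv (X := TopCat.of X)).symm
  have hf : coboundary R (Sing X) 0 f.1 = 0 := f.2
  have key : ∀ x y, f.1 (σ₀ x) = f.1 (σ₀ y) := by
    intro x y
    obtain ⟨p⟩ := PathConnectedSpace.joined x y
    let e := TopCat.toSSetObjEdgeEquiv.symm (TopCat.pathEquiv (X := TopCat.of X).symm p)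
    have : ∑ i : Fin 2, (-1 : R) ^ (i : ℕ) * f.1 ((Sing X).δ i e.edge) = 0 := congrFun hf e.edge
    rw [Fin.sum_univ_two] at this
    have h₀ : (Sing X).δ 0 e.edge = σ₀ y := e.tgt_eq
    have h₁ : (Sing X).δ 1 e.edge = σ₀ x := e.src_eq
    rw [h₀, h₁] at this
    simp at this
    linear_combination -this
  obtain ⟨x⟩ : Nonempty X := inferInstance
  refine Submodule.mem_span_singleton.2 ⟨f.1 (σ₀ x), ?_⟩
  funext σ
  obtain ⟨y, rfl⟩ : ∃ y, σ₀ y = σ :=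
    (TopCat.toSSetObj₀Equiv (X := TopCat.of X)).symm.surjective σ
  simp [key x y]

section Duality

variable {R : Type*} [Field R] {S : SSet}

/-- Over a field, a cycle that is not a boundary is detected by a cocycle. -/
theorem exists_cocycle_evalChain_ne_zero {k : ℕ} {c : Chain R S k} (hc : c ∉ boundaries R S k) :
    ∃ g : cocycles R S k, evalChain g.1 c ≠ 0 := by
  obtain ⟨φ, hφ, hφ'⟩ := Submodule.exists_le_ker_of_notMem hc
  have e : evalChain (fun σ => φ (simplexChain R σ)) = φ :=
    chain_hom_ext fun σ => by simp [evalChain, chainLift_simplexChain]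
  refine ⟨⟨fun σ => φ (simplexChain R σ), ?_⟩, by rwa [e]⟩
  change coboundary R S k _ = 0
  funext σ
  have h := evalChain_boundary (fun σ => φ (simplexChain R σ)) (simplexChain R σ : Chain R S (k + 1))
  rw [e, evalChain, chainLift_simplexChain] at h
  rw [← h]
  exact hφ' ⟨_, rfl⟩

/-- A coboundary vanishes on cycles. -/
theorem evalChain_eq_zero {k : ℕ} {f : Cochain R S k} (hf : f ∈ coboundaries R S k)
    {c : Chain R S k} (hc : c ∈ cycles R S k) : evalChain f c = 0 := by
  cases k with
  | zero =>
    rw [show f = 0 from hf]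
    exact congrArg (fun F : Chain R S 0 →ₗ[R] R => F c)
      (chain_hom_ext (G := 0) fun σ => by simp [evalChain, chainLift_simplexChain])
  | succ k =>
    obtain ⟨e, rfl⟩ := hf
    rw [← evalChain_boundary, show boundary R S k c = 0 from hc, map_zero]

/-- If the cap product with a class in `H_n` is injective on `Hⁱ`, then every nonzero class of
degree `i` has a nonzero cup product with some class of complementary degree. -/
theorem exists_cup_ne_zero {i j n : ℕ} (h : i + j = n) (μ : Homology R S n)
    (hμ : Function.Injective fun x : Cohomology R S i => cap R S h x μ)
    {y : Cohomology R S i} (hy : y ≠ 0) : ∃ z : Cohomology R S j, cup R S h y z ≠ 0 := by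
  induction y using Submodule.Quotient.induction_on with | _ f
  induction μ using Submodule.Quotient.induction_on with | _ c
  have hc : capChain R S h f.1 c.1 ∉ boundaries R S j := by
    intro hb
    refine hy (hμ ?_)
    change cap R S h (cohomologyClass R S i f) (homologyClass R S n c) =
      cap R S h 0 (homologyClass R S n c)
    rw [cap_homologyClass, LinearMap.map_zero₂]
    exact homologyClass_eq_zero hb
  obtain ⟨g, hg⟩ := exists_cocycle_evalChain_ne_zero hc
  refine ⟨cohomologyClass R S j g, fun h0 => hg ?_⟩
  rw [evalChain_capChain]
  exact evalChain_eq_zero ((Submodule.Quotient.mk_eq_zero _).1 h0) c.2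

end Duality

/-! ### Products of homogeneous classes in the cohomology ring -/

section Ring

variable {R : Type*} [CommRing R] {X : Type*} [TopologicalSpace X]

theorem homogeneous_eq_zero {k : ℕ} {x : Cohomology R (Sing X) k} :
    homogeneous x = 0 ↔ x = 0 :=
  ⟨fun h => DirectSum.of_injective k (h.trans (map_zero _).symm), fun h => by
    rw [h]; exact map_zero _⟩

theorem homogeneous_mul {i j n : ℕ} (h : i + j = n) (x : Cohomology R (Sing X) i)
    (y : Cohomology R (Sing X) j) :
    homogeneous x * homogeneous y = homogeneous (cup R (Sing X) h x y) := by
  subst h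
  exact DirectSum.of_mul_of x y

theorem homogeneous_smul {k : ℕ} (c : R) (x : Cohomology R (Sing X) k) :
    homogeneous (c • x) = c • homogeneous x :=
  (DirectSum.lof R ℕ (Cohomology R (Sing X)) k).map_smul c x

theorem homogeneous_mul_comm {i j : ℕ} (x : Cohomology R (Sing X) i)
    (y : Cohomology R (Sing X) j) :
    homogeneous x * homogeneous y = homogeneous y * homogeneous x ∨
      homogeneous x * homogeneous y = -(homogeneous y * homogeneous x) := by
  rw [homogeneous_mul rfl, homogeneous_mul (add_comm j i), cup_comm rfl (add_comm j i),
    homogeneous_smul]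
  rcases neg_one_pow_eq_or R (i * j) with h | h <;> simp [h]

theorem smul_mul_cohomologyRing (c : R) (x y : CohomologyRing R X) : (c • x) * y = c • (x * y) := by
  induction x using DirectSum.induction_on with
  | zero => simp
  | add x x' hx hx' => rw [smul_add, add_mul, hx, hx', add_mul, smul_add]
  | of i x =>
    induction y using DirectSum.induction_on with
    | zero => simp
    | add y y' hy hy' => rw [mul_add, hy, hy', mul_add, smul_add]
    | of j y =>
      change c • homogeneous x * homogeneous y = c • (homogeneous x * homogeneous y)
      rw [← homogeneous_smul, homogeneous_mul rfl, homogeneous_mul rfl, LinearMap.map_smul₂,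
        homogeneous_smul]

theorem mul_smul_cohomologyRing (c : R) (x y : CohomologyRing R X) : x * (c • y) = c • (x * y) := by
  induction x using DirectSum.induction_on with
  | zero => simp
  | add x x' hx hx' => rw [add_mul, hx, hx', add_mul, smul_add]
  | of i x =>
    induction y using DirectSum.induction_on with
    | zero => simp
    | add y y' hy hy' => rw [smul_add, mul_add, hy, hy', mul_add, smul_add]
    | of j y =>
      change homogeneous x * c • homogeneous y = c • (homogeneous x * homogeneous y)
      rw [← homogeneous_smul, homogeneous_mul rfl, homogeneous_mul rfl, map_smul,
        homogeneous_smul]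

/-- The product in the cohomology ring of a list of homogeneous classes, each given with its
degree. -/
noncomputable def classProd (l : List (Σ k, Cohomology R (Sing X) k)) : CohomologyRing R X :=
  (l.map fun x => homogeneous x.2).prod

theorem classProd_append (l l' : List (Σ k, Cohomology R (Sing X) k)) :
    classProd (l ++ l') = classProd l * classProd l' := by
  simp [classProd]

/-- By graded commutativity, permuting the factors changes a product at most by a sign. -/
theorem classProd_perm {l l' : List (Σ k, Cohomology R (Sing X) k)} (h : l.Perm l') :
    classProd l = classProd l' ∨ classProd l = -classProd l' := by
  induction h with
  | nil => exact Or.inl rfl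
  | cons x _ ih =>
    simp only [classProd, List.map_cons, List.prod_cons] at ih ⊢
    rcases ih with h | h <;> simp [h]
  | swap x y l =>
    simp only [classProd, List.map_cons, List.prod_cons, ← mul_assoc]
    rcases homogeneous_mul_comm y.2 x.2 with h | h <;> simp [h]
  | trans _ _ h₁ h₂ =>
    rcases h₁ with h₁ | h₁ <;> rcases h₂ with h₂ | h₂ <;> simp [h₁, h₂]

theorem classProd_ne_zero_of_perm {l l' : List (Σ k, Cohomology R (Sing X) k)} (h : l.Perm l')
    (hl : classProd l ≠ 0) : classProd l' ≠ 0 := by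
  intro h0
  rcases classProd_perm h with h | h <;> simp [h, h0] at hl

theorem exists_classProd_eq (l : List (Σ k, Cohomology R (Sing X) k)) :
    ∃ y : Cohomology R (Sing X) (l.map Sigma.fst).sum, classProd l = homogeneous y := by
  induction l with
  | nil => exact ⟨cohomologyOne R (Sing X), rfl⟩
  | cons x l ih =>
    obtain ⟨y, hy⟩ := ih
    refine ⟨cup R (Sing X) (by simp) x.2 y, ?_⟩
    rw [← homogeneous_mul, ← hy]
    simp [classProd]

theorem ne_zero_of_mem_of_classProd_ne_zero {l : List (Σ k, Cohomology R (Sing X) k)}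
    (hl : classProd l ≠ 0) {x : Σ k, Cohomology R (Sing X) k} (hx : x ∈ l) : x.2 ≠ 0 := by
  intro h0
  refine hl (List.prod_eq_zero (List.mem_map.2 ⟨x, hx, ?_⟩))
  exact homogeneous_eq_zero.2 h0

theorem length_le_cupLength {l : List (Σ k, Cohomology R (Sing X) k)}
    (hpos : ∀ x ∈ l, 0 < x.1) (hl : classProd l ≠ 0) : (l.length : ℕ∞) ≤ cupLength R X := by
  refine le_sSup ⟨l.length, fun i => (l.get i).1, fun i => (l.get i).2,
    fun i => hpos _ (List.get_mem l i), ?_, rfl⟩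
  have e : (List.ofFn fun i => homogeneous (l.get i).2) = l.map fun x => homogeneous x.2 := by
    conv_rhs => rw [← List.ofFn_get l, List.map_ofFn]
    rfl
  rwa [e]

theorem cupLength_le {B : ℕ∞} (h : ∀ l : List (Σ k, Cohomology R (Sing X) k),
    (∀ x ∈ l, 0 < x.1) → classProd l ≠ 0 → (l.length : ℕ∞) ≤ B) : cupLength R X ≤ B := by
  refine sSup_le ?_
  rintro _ ⟨m, d, a, hd, ha, rfl⟩
  have := h (List.ofFn fun i => ⟨d i, a i⟩) (fun x hx => ?_) ?_
  · simpa using this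
  · obtain ⟨i, rfl⟩ := List.mem_ofFn.1 hx
    exact hd i
  · rwa [classProd, List.map_ofFn]

/-- A positive finite height is attained. -/
theorem homogeneous_pow_ne_zero {k m : ℕ} {x : Cohomology R (Sing X) k} (h : height x = m)
    (hm : 0 < m) : homogeneous x ^ m ≠ 0 := by
  intro h0
  have : height x ≤ ((m - 1 : ℕ) : ℕ∞) := by
    refine sSup_le ?_
    rintro _ ⟨p, hp, rfl⟩
    have : p < m := by
      by_contra hpm
      exact hp (pow_eq_zero_of_le (not_lt.1 hpm) h0)
    exact_mod_cast Nat.le_sub_one_of_lt this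
  rw [h] at this
  have := Nat.cast_le.1 this
  lia

/-- If a product of classes of a fixed degree is nonzero, then so is some product of as many
elements of a given basis. -/
theorem exists_basis_prod_ne_zero {ι : Type*} [Finite ι] {r : ℕ}
    (a : Module.Basis ι R (Cohomology R (Sing X) r)) (xs : List (Cohomology R (Sing X) r))
    (z : CohomologyRing R X) (h : z * (xs.map homogeneous).prod ≠ 0) :
    ∃ is : List ι, is.length = xs.length ∧
      z * (is.map fun i => homogeneous (a i)).prod ≠ 0 := by
  induction xs generalizing z with
  | nil => exact ⟨[], rfl, by simpa using h⟩
  | cons x xs ih =>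
    obtain ⟨i, hi⟩ : ∃ i, z * homogeneous (a i) * (xs.map homogeneous).prod ≠ 0 := by
      by_contra! hall
      have key : ∀ y ∈ Submodule.span R (Set.range a),
          z * homogeneous y * (xs.map homogeneous).prod = 0 := by
        intro y hy
        induction hy using Submodule.span_induction with
        | mem y hy => obtain ⟨i, rfl⟩ := hy; exact hall i
        | zero => rw [homogeneous_eq_zero.2 rfl]; simp
        | add y y' _ _ hy hy' =>
          rw [show homogeneous (y + y') = homogeneous y + homogeneous y' from map_add _ _ _,
            mul_add, add_mul, hy, hy', add_zero]
        | smul c y _ hy =>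
          rw [homogeneous_smul, mul_smul_cohomologyRing, smul_mul_cohomologyRing, hy, smul_zero]
      refine h ?_
      rw [List.map_cons, List.prod_cons, ← mul_assoc]
      exact key x (a.span_eq ▸ Submodule.mem_top)
    obtain ⟨is, hlen, his⟩ := ih _ hi
    refine ⟨i :: is, by simp [hlen], ?_⟩
    rwa [List.map_cons, List.prod_cons, ← mul_assoc]

/-- If `Hʳ` has a basis `a` with `(a i)^(k i + 1) = 0` for all `i`, then a nonzero product of
homogeneous classes has at most `∑ k i` factors of degree `r`. -/
theorem countP_degree_le {ι : Type*} [Fintype ι] {r : ℕ}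
    (a : Module.Basis ι R (Cohomology R (Sing X) r)) (k : ι → ℕ)
    (hk : ∀ i, homogeneous (a i) ^ (k i + 1) = 0) {l : List (Σ k, Cohomology R (Sing X) k)}
    (hl : classProd l ≠ 0) : l.countP (fun x => decide (x.1 = r)) ≤ ∑ i, k i := by
  classical
  obtain ⟨xs, hxs⟩ : ∃ xs : List (Cohomology R (Sing X) r),
      xs.map (Sigma.mk r) = l.filter (fun x => decide (x.1 = r)) := by
    have : ∀ x ∈ l.filter (fun x => decide (x.1 = r)), x ∈ Set.range (Sigma.mk r) := by
      intro x hx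
      obtain ⟨d, x⟩ := x
      obtain rfl : d = r := by simpa using (List.mem_filter.1 hx).2
      exact ⟨x, rfl⟩
    exact (Set.range_list_map (Sigma.mk r)).ge this
  have h₁ := classProd_ne_zero_of_perm (List.filter_append_perm (fun x => decide (x.1 = r)) l).symm
    hl
  rw [classProd_append, ← hxs] at h₁
  have h₂ : (1 : CohomologyRing R X) * (xs.map homogeneous).prod ≠ 0 := by
    have := left_ne_zero_of_mul h₁
    rwa [classProd, List.map_map, ← one_mul (List.prod _)] at this
  obtain ⟨is, hlen, his⟩ := exists_basis_prod_ne_zero a xs 1 h₂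
  have hcount : ∀ i, is.count i ≤ k i := by
    intro i
    by_contra! hi
    obtain ⟨rest, hrest⟩ := (List.replicate_sublist_iff.2 hi).exists_perm_append
    have h₃ : classProd (is.map fun i => ⟨r, a i⟩) ≠ 0 := by
      rwa [classProd, List.map_map, ← one_mul (List.prod _)]
    refine classProd_ne_zero_of_perm (hrest.map _) h₃ ?_
    rw [List.map_append, classProd_append, List.map_replicate, classProd, List.map_replicate,
      List.prod_replicate, hk, zero_mul]
  calc l.countP (fun x => decide (x.1 = r)) = is.length := by
        rw [hlen, List.countP_eq_length_filter, ← hxs, List.length_map]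
    _ = ∑ i, is.count i := by
        simpa using (Multiset.sum_count_eq_card (s := Finset.univ) (m := (is : Multiset ι))
          (by simp)).symm
    _ ≤ ∑ i, k i := Finset.sum_le_sum fun i _ => hcount i

end Ring

/-- Raising the degree of `b` elements from `r` to `q` adds at most `(q - r) b` to the sum.
The subtraction may truncate: the bound holds for `q ≤ r` too. -/
theorem mul_length_le_sum_add {α : Type*} (d : α → ℕ) {r q : ℕ} {l : List α}
    (h : ∀ x ∈ l, d x = r ∨ q ≤ d x) :
    q * l.length ≤ (l.map d).sum + (q - r) * l.countP (fun x => decide (d x = r)) := by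
  induction l with
  | nil => simp
  | cons x l ih =>
    have := ih fun y hy => h y (List.mem_cons_of_mem _ hy)
    rw [List.length_cons, List.map_cons, List.sum_cons, List.countP_cons, mul_add, mul_add]
    rcases h x List.mem_cons_self with hx | hx
    · simp [hx]
      lia
    · lia

/-! ### Degrees in Poincaré spaces -/

section Poincare

variable {R : Type*} [Field R] {X : Type*} [TopologicalSpace X] {n : ℕ}

theorem IsPoincareSpace.degree_le (hX : IsPoincareSpace R X n) {k : ℕ}
    {y : Cohomology R (Sing X) k} (hy : y ≠ 0) : k ≤ n := by
  by_contra! h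
  have := hX.cohomology_vanishing k h
  exact hy (Subsingleton.elim _ _)

theorem IsPoincareSpace.sum_degree_le (hX : IsPoincareSpace R X n)
    {l : List (Σ k, Cohomology R (Sing X) k)} (hl : classProd l ≠ 0) :
    (l.map Sigma.fst).sum ≤ n := by
  obtain ⟨y, hy⟩ := exists_classProd_eq l
  exact hX.degree_le fun h => hl (hy.trans (homogeneous_eq_zero.2 h))

theorem nontrivial_reducedCohomology {k : ℕ} (hk : 0 < k) {y : Cohomology R (Sing X) k}
    (hy : y ≠ 0) : Nontrivial (ReducedCohomology R (Sing X) k) := by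
  obtain ⟨k, rfl⟩ := Nat.exists_eq_succ_of_ne_zero hk.ne'
  exact (⟨y, 0, hy⟩ : Nontrivial (Cohomology R (Sing X) (k + 1)))

/-- By duality, a nonzero product of total degree less than `n` can be prolonged by one more
class of positive degree. -/
theorem IsPoincareSpace.succ_length_le_cupLength (hX : IsPoincareSpace R X n)
    {l : List (Σ k, Cohomology R (Sing X) k)} (hpos : ∀ x ∈ l, 0 < x.1) (hl : classProd l ≠ 0)
    (hn : (l.map Sigma.fst).sum < n) : ((l.length + 1 : ℕ) : ℕ∞) ≤ cupLength R X := by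
  obtain ⟨y, hy⟩ := exists_classProd_eq l
  obtain ⟨j, hj⟩ := Nat.exists_eq_add_of_lt hn
  obtain ⟨μ, -, hμ⟩ := hX.duality
  obtain ⟨z, hz⟩ := exists_cup_ne_zero (show _ + (j + 1) = n by rw [hj, add_assoc]) μ
    (hμ _ _ _).1 (y := y) fun h => hl (hy.trans (homogeneous_eq_zero.2 h))
  have h := length_le_cupLength (l := l ++ [⟨j + 1, z⟩]) (fun x hx => ?_) ?_
  · simpa using h
  · rcases List.mem_append.1 hx with hx | hx
    · exact hpos x hx
    · obtain rfl := List.mem_singleton.1 hx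
      exact j.succ_pos
  · rw [classProd_append, hy, show classProd [⟨j + 1, z⟩] = homogeneous z by simp [classProd],
      homogeneous_mul (show _ + (j + 1) = n by rw [hj, add_assoc])]
    exact fun h => hz (homogeneous_eq_zero.1 h)

theorem natCast_div_le (n r : ℕ) : ((n / r : ℕ) : ENNReal) ≤ (n : ENNReal) / (r : ENNReal) := by
  rcases Nat.eq_zero_or_pos r with rfl | hr
  · simp
  · rw [ENNReal.le_div_iff_mul_le (by simp [hr.ne']) (by simp)]
    exact_mod_cast Nat.div_mul_le_self n r

end Poincare

end SingularTheory

theorem theoremA {R : Type*} [Field R] {X : Type*} [TopologicalSpace X] {n r q : ℕ}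
    (hX : IsPoincareSpace R X n)
    -- `r` and `q` are the first two degrees below `n` of nonzero reduced cohomology groups
    (hr : IsLeast {k : ℕ | k < n ∧ Nontrivial (ReducedCohomology R (Sing X) k)} r)
    -- where `q = r` if there is only one such degree
    (hq : IsLeast {k : ℕ | r < k ∧ k < n ∧ Nontrivial (ReducedCohomology R (Sing X) k)} q ∨
      q = r ∧ ∀ k : ℕ, r < k → k < n → Subsingleton (ReducedCohomology R (Sing X) k)) :
    0 < r ∧
    -- the general upper bound
    (cupLength R X : ENNReal) ≤ (n : ENNReal) / (r : ENNReal) ∧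
    -- equality, given a class of height `n / r`
    ((∃ x : Cohomology R (Sing X) r, x ≠ 0 ∧ (r : ℕ∞) * height x = (n : ℕ∞)) →
      (cupLength R X : ENNReal) = (n : ENNReal) / (r : ENNReal)) ∧
    -- the lower bound from a nonzero product of degree below `n`
    (∀ (s : ℕ) (a : Fin s → Cohomology R (Sing X) r) (t : Fin s → ℕ),
      (∀ i, a i ≠ 0) → 0 < ∑ i, t i → r * ∑ i, t i < n →
      (List.ofFn fun i => homogeneous (a i) ^ t i).prod ≠ 0 →
      ((1 + ∑ i, t i : ℕ) : ℕ∞) ≤ cupLength R X) ∧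
    -- the improved upper bound
    (r < q → ∀ (m : ℕ) (a : Module.Basis (Fin m) R (Cohomology R (Sing X) r)) (k : Fin m → ℕ),
      (∀ i, 0 < k i) → (∀ i, homogeneous (a i) ^ (k i + 1) = 0) → r * ∑ i, k i < n →
      cupLength R X ≤ ((∑ i, k i + (n - r * ∑ i, k i) / q : ℕ) : ℕ∞) ∧
      ((∑ i, k i + (n - r * ∑ i, k i) / q : ℕ) : ENNReal) < (n : ENNReal) / (r : ENNReal)) := by

  have hX' := hX.pathConnected
  have hr0 : 0 < r := by
    rcases Nat.eq_zero_or_pos r with rfl | h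
    · exact absurd hr.1.2
        (not_nontrivial_iff_subsingleton.2 subsingleton_reducedCohomology_zero)
    · exact h
  have hdeg : ∀ l : List (Σ k, Cohomology R (Sing X) k), (∀ x ∈ l, 0 < x.1) → classProd l ≠ 0 →
      ∀ x ∈ l, x.1 ≤ n ∧ Nontrivial (ReducedCohomology R (Sing X) x.1) := fun l hpos hl x hx =>
    have hx0 := ne_zero_of_mem_of_classProd_ne_zero hl hx
    ⟨hX.degree_le hx0, nontrivial_reducedCohomology (hpos x hx) hx0⟩
  have hle : cupLength R X ≤ ((n / r : ℕ) : ℕ∞) := by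
    refine cupLength_le fun l hpos hl => Nat.cast_le.2 ?_
    have h : ∀ x ∈ l.map Sigma.fst, r ≤ x := by
      intro d hd
      obtain ⟨x, hx, rfl⟩ := List.mem_map.1 hd
      obtain ⟨hxn, hx'⟩ := hdeg l hpos hl x hx
      rcases hxn.lt_or_eq with hlt | heq
      · exact hr.2 ⟨hlt, hx'⟩
      · exact heq ▸ hr.1.1.le
    have := List.card_nsmul_le_sum _ _ h
    rw [Nat.le_div_iff_mul_le hr0]
    simpa using this.trans (hX.sum_degree_le hl)
  have hle' : (cupLength R X : ENNReal) ≤ (n : ENNReal) / (r : ENNReal) :=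
    (ENat.toENNReal_le.2 hle).trans (by simpa using natCast_div_le n r)
  refine ⟨hr0, hle', ?_, ?_, ?_⟩
  · rintro ⟨x, -, hx⟩
    refine le_antisymm hle' ?_
    obtain ⟨m, hm⟩ : ∃ m : ℕ, height x = m := by
      refine (ENat.ne_top_iff_exists.1 fun htop => ?_).imp fun _ => Eq.symm
      rw [htop, ENat.mul_top (by simpa using hr0.ne')] at hx
      exact ENat.top_ne_natCast n hx
    have hrm : r * m = n := by
      rw [hm] at hx
      exact_mod_cast hx
    have hm0 : 0 < m := Nat.pos_of_ne_zero fun h0 => by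
      have := hr.1.1
      simp [h0] at hrm
      lia
    have hcup := length_le_cupLength (l := List.replicate m ⟨r, x⟩)
      (fun y hy => by rw [List.eq_of_mem_replicate hy]; exact hr0)
      (by
        rw [classProd, List.map_replicate, List.prod_replicate]
        exact homogeneous_pow_ne_zero hm hm0)
    rw [List.length_replicate] at hcup
    refine le_trans ?_ (ENat.toENNReal_le.2 hcup)
    rw [ENNReal.div_le_iff (by simp [hr0.ne']) (by simp), ← hrm]
    simp [mul_comm]
  · intro s a t _ _ hlt hprod
    have hlen : (List.ofFn fun i => List.replicate (t i)
        (⟨r, a i⟩ : Σ k, Cohomology R (Sing X) k)).flatten.length = ∑ i, t i := by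
      simp [List.length_flatten, List.map_ofFn, Function.comp_def, List.sum_ofFn]
    have hmem : ∀ x ∈ (List.ofFn fun i => List.replicate (t i)
        (⟨r, a i⟩ : Σ k, Cohomology R (Sing X) k)).flatten, x.1 = r := by
      intro x hx
      obtain ⟨l, hl, hx⟩ := List.mem_flatten.1 hx
      obtain ⟨i, rfl⟩ := List.mem_ofFn.1 hl
      rw [List.eq_of_mem_replicate hx]
    have h := hX.succ_length_le_cupLength (l := (List.ofFn fun i => List.replicate (t i)
        ⟨r, a i⟩).flatten) (fun x hx => hmem x hx ▸ hr0) ?_ ?_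
    · rwa [hlen, add_comm] at h
    · rw [classProd, List.map_flatten, List.prod_flatten, List.map_map, List.map_ofFn]
      simpa [Function.comp_def] using hprod
    · rw [List.map_congr_left hmem, List.map_const', List.sum_replicate, hlen, smul_eq_mul,
        mul_comm]
      exact hlt
  · intro hrq m a k _ hk hlt
    have hq' := hq.resolve_right fun h => hrq.ne' h.1
    have hq0 : 0 < q := hr0.trans hrq
    constructor
    · refine cupLength_le fun l hpos hl => Nat.cast_le.2 ?_
      have h₁ := mul_length_le_sum_add (r := r) (q := q) (l := l) Sigma.fst fun x hx => by
        obtain ⟨hxn, hx'⟩ := hdeg l hpos hl x hx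
        rcases hxn.lt_or_eq with hxlt | heq
        · rcases (hr.2 ⟨hxlt, hx'⟩).eq_or_lt with h | h
          · exact Or.inl h.symm
          · exact Or.inr (hq'.2 ⟨h, hxlt, hx'⟩)
        · exact Or.inr (heq ▸ hq'.1.2.1.le)
      have h₂ := hX.sum_degree_le hl
      have h₃ := Nat.mul_le_mul_left (q - r) (countP_degree_le a k hk hl)
      have h₄ : (l.length - ∑ i, k i) * q ≤ n - r * ∑ i, k i := by
        have e : (q - r) * ∑ i, k i + r * ∑ i, k i = q * ∑ i, k i := by
          rw [← add_mul, Nat.sub_add_cancel hrq.le]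
        rw [Nat.sub_mul, mul_comm l.length, mul_comm _ q]
        lia
      have h₅ := (Nat.le_div_iff_mul_le hq0).2 h₄
      lia
    · rw [ENNReal.lt_div_iff_mul_lt (by simp [hr0.ne']) (by simp)]
      have h₁ := Nat.div_mul_le_self (n - r * ∑ i, k i) q
      have h₂ : (∑ i, k i + (n - r * ∑ i, k i) / q) * r < n := by
        rw [add_mul, mul_comm _ r]
        -- either the quotient vanishes or replacing the factor `q` by `r` makes it smaller
        rcases Nat.eq_zero_or_pos ((n - r * ∑ i, k i) / q) with h0 | h0
        · simpa [h0] using hlt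
        · have := Nat.mul_lt_mul_of_pos_left hrq h0
          lia
      exact_mod_cast h₂
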